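/- A pseudovariety of monoids is a class of finite monoids closed under submonoids, homomorphic images and finite direct products. A finite semigroup is aperiodic if all its subgroups are trivial. For a pseudovariety of monoids $\mathbf V$, let $\mathbf A \mathbin{\bigcirc_{\mathrm m}} \mathbf V$ (the Mal'cev product with the class $\mathbf A$ of finite aperiodic semigroups) be the pseudovariety of monoids generated by the finite monoids $M$ that admit a monoid homomorphism $\varphi : M \to N$ with $N \in \mathbf V$ such that $\varphi^{-1}(e)$ is an aperiodic semigroup for each idempotent $e \in N$. A pro-$\mathbf V$ monoid is a compact Hausdorff topological monoid whose points are separated by continuous homomorphisms to (discrete) members of $\mathbf V$. A free pro-$\mathbf V$ monoid on a topological space $X$ is a pro-$\mathbf V$ monoid $F$ with a continuous map $\iota : X \to F$ such that every continuous map $f : X \to T$ to a pro-$\mathbf V$ monoid $T$ is of the form $\hat f\circ\iota$ for a unique continuous monoid homomorphism $\hat f : F \to T$. A finite semigroup $S$ is completely regular if for each $s \in S$ there is an integer $m > 1$ with $s^m = s$. **Theorem.** Let $\mathbf V$ be a pseudovariety of monoids such that $\mathbf A \mathbin{\bigcirc_{\mathrm m}} \mathbf V = \mathbf V$. Then every finite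 subsemigroup of a free pro-$\mathbf V$ monoid (on any topological space) is completely regular. -/

import Mathlib

universe u v

/-- A pseudovariety of monoids: a class of finite monoids closed under submonoids, homomorphic
images and finite direct products (including the empty product). Closure under isomorphism
follows from either of the first two closure properties. -/
structure MonoidPseudovariety where
  /-- the monoid `M` belongs to the pseudovariety -/
  mem : ∀ (M : Type u) [Monoid M], Prop
  finite_of_mem : ∀ (M : Type u) [Monoid M], mem M → Finite M
  mem_of_injective : ∀ (M N : Type u) [Monoid M] [Monoid N] (f : M →* N),
    Function.Injective f → mem N → mem M
  mem_of_surjective : ∀ (M N : Type u) [Monoid M] [Monoid N] (f : M →* N),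
    Function.Surjective f → mem M → mem N
  mem_punit : mem PUnit.{u + 1}
  mem_prod : ∀ (M N : Type u) [Monoid M] [Monoid N], mem M → mem N → mem (M × N)

/-- The pseudovariety of monoids generated by the finite monoids in a class `K`: the intersection
of all pseudovarieties that contain them. -/
def MonoidPseudovariety.generatedBy (K : ∀ (M : Type u) [Monoid M], Prop) :
    MonoidPseudovariety.{u} where
  mem M _ := Finite M ∧ ∀ W : MonoidPseudovariety.{u},
    (∀ (L : Type u) [Monoid L], Finite L → K L → W.mem L) → W.mem M
  finite_of_mem _ _ h := h.1
  mem_of_injective M N _ _ f hf h :=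
    ⟨have := h.1; Finite.of_injective f hf,
      fun W hW => W.mem_of_injective M N f hf (h.2 W hW)⟩
  mem_of_surjective M N _ _ f hf h :=
    ⟨have := h.1; Finite.of_surjective f hf,
      fun W hW => W.mem_of_surjective M N f hf (h.2 W hW)⟩
  mem_punit := ⟨inferInstance, fun W _ => W.mem_punit⟩
  mem_prod M N _ _ h₁ h₂ :=
    ⟨have := h₁.1; have := h₂.1; inferInstance,
      fun W hW => W.mem_prod M N (h₁.2 W hW) (h₂.2 W hW)⟩

/-- A subsemigroup is a subgroup if it is a group under the restricted multiplication (its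
identity is some idempotent of the ambient semigroup). -/
def Subsemigroup.IsGroupLike {S : Type u} [Semigroup S] (T : Subsemigroup S) : Prop :=
  ∃ e ∈ T, (∀ x ∈ T, e * x = x ∧ x * e = x) ∧ ∀ x ∈ T, ∃ y ∈ T, x * y = e ∧ y * x = e

/-- The class of finite aperiodic semigroups: finite semigroups all of whose subgroups are
trivial. -/
def FiniteAperiodic (S : Type u) [Semigroup S] : Prop :=
  Finite S ∧ ∀ T : Subsemigroup S, T.IsGroupLike → (T : Set S).Subsingleton

/-- The preimage of an idempotent under a monoid homomorphism, as a subsemigroup. -/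
def idempotentPreimage {M N : Type u} [Monoid M] [Monoid N] (φ : M →* N) (e : N)
    (he : IsIdempotentElem e) : Subsemigroup M where
  carrier := {m | φ m = e}
  mul_mem' {a b} ha hb := by
    have ha' : φ a = e := ha
    have hb' : φ b = e := hb
    change φ (a * b) = e
    rw [map_mul, ha', hb']
    exact he

/-- The Mal'cev product of a class `K` of finite semigroups with a pseudovariety of monoids `W`:
the pseudovariety generated by the finite monoids `M` that admit a homomorphism to some `N` in `W`
under which the preimage of every idempotent of `N` belongs to `K`. -/
def malcevProduct (K : ∀ (S : Type u) [Semigroup S], Prop) (W : MonoidPseudovariety.{u}) :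
    MonoidPseudovariety.{u} :=
  MonoidPseudovariety.generatedBy fun M _ =>
    ∃ (N : Type u) (_ : Monoid N) (φ : M →* N), W.mem N ∧
      ∀ (e : N) (he : IsIdempotentElem e), K (idempotentPreimage φ e he)

/-- A pro-`V` monoid: a compact Hausdorff topological monoid that is residually in `V`, i.e. whose
points are separated by continuous homomorphisms to (discrete) members of `V`. -/
structure IsProV (V : MonoidPseudovariety.{u}) (T : Type u) [Monoid T] [TopologicalSpace T] :
    Prop where
  continuousMul : ContinuousMul T
  compactSpace : CompactSpace T
  t2Space : T2Space T
  separates : ∀ x y : T, x ≠ y →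
    ∃ (M : Type u) (_ : Monoid M) (_ : TopologicalSpace M) (_ : DiscreteTopology M),
      V.mem M ∧ ∃ φ : T →ₜ* M, φ x ≠ φ y

/-- `F` together with `ι : X → F` is a free pro-`V` monoid on the topological space `X`: `F` is
pro-`V`, `ι` is continuous, and every continuous map from `X` to a pro-`V` monoid extends uniquely
along `ι` to a continuous monoid homomorphism. -/
structure IsFreeProV (V : MonoidPseudovariety.{u}) {X : Type v} [TopologicalSpace X]
    {F : Type u} [Monoid F] [TopologicalSpace F] (ι : X → F) : Prop where
  isProV : IsProV V F
  continuous : Continuous ι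
  existsUnique_lift : ∀ (T : Type u) [Monoid T] [TopologicalSpace T], IsProV V T →
    ∀ f : X → T, Continuous f → ∃! φ : F →ₜ* T, ∀ x, φ (ι x) = f x

/-- Complete regularity of a (finite) subsemigroup of a monoid: each of its elements `s` satisfies
`s ^ m = s` for some `m > 1`. -/
def Subsemigroup.IsCompletelyRegular {M : Type u} [Monoid M] (S : Subsemigroup M) : Prop :=
  ∀ s ∈ S, ∃ m : ℕ, 1 < m ∧ s ^ m = s

/-! The point is to lower the index of s: if s^(i+1+p) = s^(i+1) with i ≥ 1, then s^(i+p) = s^i. The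
projection of the Schützenberger expansion onto M has aperiodic idempotent fibres, so V is closed
under the expansion, and any ψ : F → M with M in V lifts to a homomorphism that also remembers the
values of cuts. If ψ separated s^(i+p) from s^i, the cut of s^(i+1) into s^i and s would also be a
cut of an arbitrarily long power of s. It falls inside one factor, so many copies of s lie to its
left or to its right. Either the image of s^i begins with a high power of s, or that of s ends with
one; such a power absorbs s^p, a contradiction. -/

/-- The Schützenberger expansion of a monoid `M`: an element of `M` together with a set of pairs
of elements of `M`, to be thought of as the values of the factorizations of a word. -/
@[ext]
structure SchutzenbergerExpansion (M : Type u) : Type u where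
  /-- the value in `M` -/
  val : M
  /-- the set of values of factorizations -/
  cuts : Set (M × M)

namespace SchutzenbergerExpansion

variable {M : Type u}

instance [Finite M] : Finite (SchutzenbergerExpansion M) :=
  Finite.of_injective (fun x => (x.val, x.cuts)) fun x y h => by
    simp only [Prod.mk.injEq] at h
    exact SchutzenbergerExpansion.ext h.1 h.2

variable [Monoid M]

instance : Monoid (SchutzenbergerExpansion M) where
  one := ⟨1, ∅⟩
  mul x y := ⟨x.val * y.val,
    {c | (∃ a b, (a, b) ∈ x.cuts ∧ c = (a, b * y.val)) ∨
      ∃ a b, (a, b) ∈ y.cuts ∧ c = (x.val * a, b)}⟩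
  mul_assoc x y z := by
    ext c
    · exact mul_assoc _ _ _
    · constructor
      · rintro (⟨a, b, ⟨_, b', h, e⟩ | ⟨a', _, h, e⟩, rfl⟩ | ⟨a, b, h, rfl⟩)
        · cases e
          exact Or.inl ⟨a, b', h, by rw [mul_assoc]; rfl⟩
        · cases e
          exact Or.inr ⟨a', _, Or.inl ⟨a', b, h, rfl⟩, rfl⟩
        · exact Or.inr ⟨_, b, Or.inr ⟨a, b, h, rfl⟩, by rw [← mul_assoc]; rfl⟩
      · rintro (⟨a, b, h, rfl⟩ | ⟨a, b, ⟨_, b', h, e⟩ | ⟨a', _, h, e⟩, rfl⟩)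
        · exact Or.inl ⟨a, _, Or.inl ⟨a, b, h, rfl⟩, by rw [mul_assoc]; rfl⟩
        · cases e
          exact Or.inl ⟨_, b', Or.inr ⟨a, b', h, rfl⟩, rfl⟩
        · cases e
          exact Or.inr ⟨a', b, h, by rw [← mul_assoc]; rfl⟩
  one_mul x := by
    ext c
    · exact one_mul _
    · constructor
      · rintro (⟨a, b, h, rfl⟩ | ⟨a, b, h, rfl⟩)
        · exact h.elim
        · exact (one_mul a).symm ▸ h
      · intro h
        exact Or.inr ⟨c.1, c.2, h, Prod.ext (one_mul _).symm rfl⟩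
  mul_one x := by
    ext c
    · exact mul_one _
    · constructor
      · rintro (⟨a, b, h, rfl⟩ | ⟨a, b, h, rfl⟩)
        · exact (mul_one b).symm ▸ h
        · exact h.elim
      · intro h
        exact Or.inl ⟨c.1, c.2, h, Prod.ext rfl (mul_one _).symm⟩

theorem mem_cuts_mul {x y : SchutzenbergerExpansion M} {c : M × M} :
    c ∈ (x * y).cuts ↔ (∃ a b, (a, b) ∈ x.cuts ∧ c = (a, b * y.val)) ∨
      ∃ a b, (a, b) ∈ y.cuts ∧ c = (x.val * a, b) :=
  Iff.rfl

/-- The projection of the Schützenberger expansion of `M` onto `M`. -/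
def valHom (M : Type u) [Monoid M] : SchutzenbergerExpansion M →* M where
  toFun := val
  map_one' := rfl
  map_mul' _ _ := rfl

theorem val_pow (x : SchutzenbergerExpansion M) (n : ℕ) : (x ^ n).val = x.val ^ n :=
  map_pow (valHom M) x n

/-- A cut of a product lies inside a single factor; j and l count the factors before and after it.
-/
theorem mem_cuts_pow_succ {x : SchutzenbergerExpansion M} {n : ℕ} {c : M × M}
    (hc : c ∈ (x ^ (n + 1)).cuts) :
    ∃ j l a b, j + l = n ∧ c = (x.val ^ j * a, b * x.val ^ l) := by
  induction n generalizing c with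
  | zero => exact ⟨0, 0, c.1, c.2, rfl, by simp⟩
  | succ n ih =>
    rw [pow_succ, mem_cuts_mul] at hc
    obtain ⟨a, b, h, rfl⟩ | ⟨a, b, h, rfl⟩ := hc
    · obtain ⟨j, l, a', b', hjl, e⟩ := ih h
      cases e
      exact ⟨j, l + 1, a', b', by omega, by rw [mul_assoc, pow_succ]⟩
    · exact ⟨n + 1, 0, a, b, rfl, by rw [val_pow]; simp⟩

/-- The elements that are trivial in `M` or have a factorization with trivial left factor. -/
def initialCutSubmonoid (M : Type u) [Monoid M] : Submonoid (SchutzenbergerExpansion M) where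
  carrier := {x | x.val = 1 ∨ (1, x.val) ∈ x.cuts}
  one_mem' := Or.inl rfl
  mul_mem' {x y} hx hy := by
    rcases hx with hx | hx
    · rcases hy with hy | hy
      · exact Or.inl ((congrArg₂ (· * ·) hx hy).trans (one_mul 1))
      · refine Or.inr (Or.inr ⟨1, _, hy, Prod.ext ?_ ?_⟩)
        · exact ((mul_one _).trans hx).symm
        · exact (congrArg (· * y.val) hx).trans (one_mul _)
    · exact Or.inr (Or.inl ⟨1, _, hx, rfl⟩)

/-- With e the idempotent value, a cut (a, b) of a factor of `x ^ n` becomes (a, be), (ea, be) or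
(ea, b), according to whether the factor is first, inner or last. All three positions occur once n =
3. -/
theorem pow_four_eq_pow_three {x : SchutzenbergerExpansion M} (hx : IsIdempotentElem x.val) :
    x ^ 4 = x ^ 3 := by
  have hv (n : ℕ) : (x ^ (n + 1)).val = x.val := by
    rw [val_pow, hx.pow_succ_eq]
  have h3 : x ^ 3 = x ^ 2 * x := pow_succ x 2
  have h4 : x ^ 4 = x ^ 3 * x := pow_succ x 3
  have hsub : (x ^ 2).cuts ⊆ (x ^ 3).cuts := by
    intro c hc
    rw [pow_two, mem_cuts_mul] at hc
    rw [h3, mem_cuts_mul]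
    rcases hc with ⟨a, b, h, rfl⟩ | ⟨a, b, h, rfl⟩
    · left
      refine ⟨a, b * x.val, ?_, by rw [mul_assoc, hx.eq]⟩
      rw [pow_two]
      exact Or.inl ⟨a, b, h, rfl⟩
    · exact Or.inr ⟨a, b, h, by rw [hv 1]⟩
  ext c
  · rw [hv 3, hv 2]
  · rw [h4, mem_cuts_mul, hv 2]
    constructor
    · rintro (⟨a, b, h, rfl⟩ | ⟨a, b, h, rfl⟩)
      · rw [h3, mem_cuts_mul, hv 1] at h
        rcases h with ⟨a', b', h, e⟩ | ⟨a', b', h, e⟩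
        · cases e
          rw [mul_assoc, hx.eq, h3]
          exact Or.inl ⟨_, _, h, rfl⟩
        · cases e
          rw [h3]
          refine Or.inl ⟨_, _, ?_, rfl⟩
          rw [pow_two]
          exact Or.inr ⟨_, _, h, rfl⟩
      · rw [h3]
        exact Or.inr ⟨a, b, h, by rw [hv 1]⟩
    · intro h
      rw [h3, mem_cuts_mul, hv 1] at h
      rcases h with ⟨a, b, h, rfl⟩ | h
      · exact Or.inl ⟨a, b, hsub h, rfl⟩
      · exact Or.inr h

theorem finiteAperiodic_idempotentPreimage [Finite M] (e : M) (he : IsIdempotentElem e) :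
    FiniteAperiodic (idempotentPreimage (valHom M) e he) := by
  refine ⟨inferInstance, fun T ⟨f, _, hf, hinv⟩ => ?_⟩
  have key : ∀ x ∈ T, x = f := by
    intro x hx
    obtain ⟨y, _, hxy, -⟩ := hinv x hx
    have hval : x.1.val = e := x.2
    have h43 : x * (x * (x * x)) = x * (x * x) := by
      apply Subtype.ext
      have := pow_four_eq_pow_three (x := x.1) (by rw [hval]; exact he)
      simpa [pow_succ, mul_assoc] using this
    -- Cancelling x twice in the subgroup reduces x⁴ = x³ to x² = x.
    have hcancel : ∀ z w : idempotentPreimage (valHom M) e he, z * x = w * x →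
        z * f = w * f := fun z w h => by
      rw [← hxy, ← mul_assoc, h, mul_assoc]
    have h32 : x * (x * x) = x * x := by
      have := hcancel (x * (x * x)) (x * x) (by simpa only [mul_assoc] using h43)
      simpa only [mul_assoc, (hf x hx).2] using this
    have h21 : x * x = x := by
      have := hcancel (x * x) x (by simpa only [mul_assoc] using h32)
      simpa only [mul_assoc, (hf x hx).2] using this
    calc x = x * f := (hf x hx).2.symm
      _ = x * x * y := by rw [← hxy, mul_assoc]
      _ = f := by rw [h21, hxy]
  intro x hx y hy
  rw [key x hx, key y hy]

end SchutzenbergerExpansion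

namespace MonoidPseudovariety

theorem mem_schutzenbergerExpansion {V : MonoidPseudovariety.{u}}
    (hV : malcevProduct (fun S _ => FiniteAperiodic S) V = V) {M : Type u} [Monoid M]
    (hM : V.mem M) : V.mem (SchutzenbergerExpansion M) := by
  have := V.finite_of_mem M hM
  rw [← hV]
  exact ⟨inferInstance, fun W hW => hW _ inferInstance ⟨M, inferInstance,
    SchutzenbergerExpansion.valHom M, hM,
    SchutzenbergerExpansion.finiteAperiodic_idempotentPreimage⟩⟩

theorem isProV_of_mem {V : MonoidPseudovariety.{u}} {M : Type u} [Monoid M] [TopologicalSpace M]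
    [DiscreteTopology M] (hM : V.mem M) : IsProV V M where
  continuousMul := inferInstance
  compactSpace := have := V.finite_of_mem M hM; inferInstance
  t2Space := inferInstance
  separates _ _ hxy := ⟨M, _, _, inferInstance, hM, ContinuousMonoidHom.id M, hxy⟩

end MonoidPseudovariety

namespace IsFreeProV

variable {V : MonoidPseudovariety.{u}} {X : Type v} [TopologicalSpace X]
  {F : Type u} [Monoid F] [TopologicalSpace F] {ι : X → F}

theorem hom_ext (hF : IsFreeProV V ι) {T : Type u} [Monoid T] [TopologicalSpace T]
    (hT : IsProV V T) {φ ψ : F →ₜ* T} (h : ∀ x, φ (ι x) = ψ (ι x)) : φ = ψ :=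
  (hF.existsUnique_lift T hT (fun x => ψ (ι x)) (ψ.continuous_toFun.comp hF.continuous)).unique
    h fun _ => rfl

/-- The universal property replaces density of the submonoid generated by X: a lift into `P` must
agree with `φ`. -/
theorem map_mem_submonoid (hF : IsFreeProV V ι) {N : Type u} [Monoid N] [TopologicalSpace N]
    [DiscreteTopology N] (hN : V.mem N) (P : Submonoid N) (φ : F →ₜ* N)
    (h : ∀ x, φ (ι x) ∈ P) (g : F) : φ g ∈ P := by
  have hP : V.mem P := V.mem_of_injective P N P.subtype Subtype.coe_injective hN
  obtain ⟨ψ, hψ, -⟩ := hF.existsUnique_lift P (MonoidPseudovariety.isProV_of_mem hP)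
    (fun x => ⟨φ (ι x), h x⟩) ((φ.continuous_toFun.comp hF.continuous).subtype_mk h)
  let incl : P →ₜ* N := ⟨P.subtype, continuous_subtype_val⟩
  have : φ = incl.comp ψ := hF.hom_ext (MonoidPseudovariety.isProV_of_mem hN) fun x =>
    (congrArg Subtype.val (hψ x)).symm
  rw [this]
  exact (ψ g).2

theorem exists_schutzenbergerExpansion_lift (hF : IsFreeProV V ι)
    (hV : malcevProduct (fun S _ => FiniteAperiodic S) V = V) {M : Type u} [Monoid M]
    [TopologicalSpace M] [DiscreteTopology M] (hM : V.mem M) (ψ : F →ₜ* M) :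
    ∃ φ : F →* SchutzenbergerExpansion M, (∀ g, (φ g).val = ψ g) ∧
      ∀ g, φ g ∈ SchutzenbergerExpansion.initialCutSubmonoid M := by
  let : TopologicalSpace (SchutzenbergerExpansion M) := ⊥
  have : DiscreteTopology (SchutzenbergerExpansion M) := ⟨rfl⟩
  have hN := MonoidPseudovariety.mem_schutzenbergerExpansion hV hM
  -- A letter carries only the cut just before itself.
  let lift (m : M) : SchutzenbergerExpansion M := ⟨m, {(1, m)}⟩
  obtain ⟨φ, hφ, -⟩ := hF.existsUnique_lift _ (MonoidPseudovariety.isProV_of_mem hN)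
    (fun x => lift (ψ (ι x)))
    ((continuous_of_discreteTopology (f := lift)).comp
      (ψ.continuous_toFun.comp hF.continuous))
  refine ⟨φ.toMonoidHom, fun g => ?_, hF.map_mem_submonoid hN _ φ fun x => ?_⟩
  · let proj : SchutzenbergerExpansion M →ₜ* M :=
      ⟨SchutzenbergerExpansion.valHom M, continuous_of_discreteTopology⟩
    have : proj.comp φ = ψ := hF.hom_ext (MonoidPseudovariety.isProV_of_mem hM) fun x =>
      congrArg SchutzenbergerExpansion.val (hφ x)
    exact congrArg (fun χ : F →ₜ* M => χ g) this
  · rw [hφ x]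
    exact Or.inr rfl

end IsFreeProV

theorem pow_add_mul_eq_of_pow_add_eq {M : Type u} [Monoid M] {s : M} {i p : ℕ}
    (h : s ^ (i + p) = s ^ i) {n : ℕ} (hn : i ≤ n) (k : ℕ) : s ^ (n + k * p) = s ^ n := by
  obtain ⟨d, rfl⟩ := Nat.exists_eq_add_of_le' hn
  induction k with
  | zero => simp
  | succ k ih =>
    rw [show d + i + (k + 1) * p = d + k * p + (i + p) by ring, pow_add, h, ← pow_add, ← ih]
    congr 1
    ring

theorem IsFreeProV.pow_add_eq_of_pow_succ_add_eq {V : MonoidPseudovariety.{u}}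
    (hV : malcevProduct (fun S _ => FiniteAperiodic S) V = V)
    {X : Type v} [TopologicalSpace X] {F : Type u} [Monoid F] [TopologicalSpace F] {ι : X → F}
    (hF : IsFreeProV V ι) {s : F} {i p : ℕ} (hi : 1 ≤ i) (hp : 1 ≤ p)
    (h : s ^ (i + 1 + p) = s ^ (i + 1)) : s ^ (i + p) = s ^ i := by
  by_contra hne
  obtain ⟨M, _, _, _, hM, ψ, hψ⟩ := hF.isProV.separates _ _ hne
  obtain ⟨φ, hφ, hcut⟩ := hF.exists_schutzenbergerExpansion_lift hV hM ψ
  rw [map_pow, map_pow] at hψ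
  have hm : ψ s ^ (i + 1 + p) = ψ s ^ (i + 1) := by rw [← map_pow, h, map_pow]
  have hm' {n : ℕ} (hn : i + 1 ≤ n) : ψ s ^ (n + p) = ψ s ^ n := by
    simpa using pow_add_mul_eq_of_pow_add_eq hm hn 1
  have hmem : (ψ s ^ i, ψ s) ∈ (φ s ^ (i + 1)).cuts := by
    rcases hcut s with h1 | h1
    · rw [hφ] at h1
      -- If ψ s = 1, then ψ cannot separate powers of s.
      exact absurd (by rw [h1, one_pow, one_pow]) hψ
    · rw [pow_succ]
      exact Or.inr ⟨1, _, h1, by rw [SchutzenbergerExpansion.val_pow, hφ, mul_one]⟩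
  -- The exponent is chosen so that j + l = i + (i + 1) * p, which forces j ≥ i + 1 or l ≥ i + 1.
  have hlong : φ s ^ (i + (i + 1) * p + 1) = φ s ^ (i + 1) := by
    rw [← map_pow, ← map_pow, ← pow_add_mul_eq_of_pow_add_eq h le_rfl (i + 1)]
    congr 2
    ring
  rw [← hlong] at hmem
  obtain ⟨j, l, a, b, hjl, e⟩ := SchutzenbergerExpansion.mem_cuts_pow_succ hmem
  rw [hφ, Prod.mk.injEq] at e
  obtain ⟨ha, hb⟩ := e
  have hq : i + 1 ≤ (i + 1) * p := Nat.le_mul_of_pos_right _ hp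
  apply hψ
  by_cases hj : i + 1 ≤ j
  · calc ψ s ^ (i + p) = ψ s ^ p * ψ s ^ i := by rw [add_comm, pow_add]
      _ = ψ s ^ (j + p) * a := by rw [ha, ← mul_assoc, ← pow_add, add_comm]
      _ = ψ s ^ i := by rw [hm' hj, ha]
  · have hl : i + 1 ≤ l := by omega
    have hs : ψ s ^ (1 + p) = ψ s := by
      calc ψ s ^ (1 + p) = ψ s * ψ s ^ p := by rw [pow_add, pow_one]
        _ = b * ψ s ^ l * ψ s ^ p := by rw [← hb]
        _ = ψ s := by rw [mul_assoc, ← pow_add, hm' hl, ← hb]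
    -- Passing from s to s^i here needs i ≥ 1, so the descent of the index stops at 1.
    simpa using pow_add_mul_eq_of_pow_add_eq (i := 1) (by rw [hs, pow_one]) hi 1

theorem Subsemigroup.exists_pow_add_eq {M : Type u} [Monoid M] {S : Subsemigroup M}
    (hS : (S : Set M).Finite) {s : M} (hs : s ∈ S) :
    ∃ i p : ℕ, 1 ≤ p ∧ s ^ (i + 1 + p) = s ^ (i + 1) := by
  have hmem (n : ℕ) : s ^ (n + 1) ∈ S := by
    induction n with
    | zero => simpa using hs
    | succ n ih => rw [pow_succ]; exact S.mul_mem ih hs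
  obtain ⟨m, n, hmn, heq⟩ := hS.exists_lt_map_eq_of_forall_mem hmem
  refine ⟨m, n - m, by omega, ?_⟩
  rw [show m + 1 + (n - m) = n + 1 by omega]
  exact heq.symm

theorem theorem1p2 (V : MonoidPseudovariety.{u})
    (hV : malcevProduct (fun S _ => FiniteAperiodic S) V = V)
    {X : Type v} [TopologicalSpace X]
    {F : Type u} [Monoid F] [TopologicalSpace F] (ι : X → F) (hF : IsFreeProV V ι)
    (S : Subsemigroup F) (hS : (S : Set F).Finite) :
    S.IsCompletelyRegular := by
  intro s hs
  obtain ⟨i, p, hp, h⟩ := S.exists_pow_add_eq hS hs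
  refine ⟨1 + p, by omega, ?_⟩
  induction i with
  | zero => simpa using h
  | succ i ih => exact ih (hF.pow_add_eq_of_pow_succ_add_eq hV (by omega) hp h)
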